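/- A \emph{turn-based discounted-sum game} consists of a finite set $V$ of $n$ vertices, partitioned into player-1 vertices $V_1$ and player-2 vertices $V_2$, a set of edges $E\subseteq V\times V$ such that every vertex $v$ has at least one successor (the set of successors is $E(v)=\{w:(v,w)\in E\}$), and rewards $r\colon E\to\mathbb Z$. Let $\lambda\in[0,1)$ be a discount factor. A (positional) strategy of player 1 is a map $\sigma\colon V_1\to V$ with $\sigma(v)\in E(v)$, and a strategy of player 2 is a map $\tau\colon V_2\to V$ with $\tau(v)\in E(v)$. A pair $(\sigma,\tau)$ and an initial vertex $v$ determine a play $v=v_0,v_1,v_2,\dots$ with payoff $\mathrm{Disc}_\lambda(G^{\sigma,\tau}_v)=\sum_{i\ge 0}\lambda^i r(v_i,v_{i+1})$. The value is $\mathrm{val}_\lambda(v)=\max_\sigma\min_\tau \mathrm{Disc}_\lambda(G^{\sigma,\tau}_v)$, and $\sigma$ is optimal if $\min_\tau \mathrm{Disc}_\lambda(G^{\sigma,\tau}_v)=\mathrm{val}_\lambda(v)$ for all $v$. A best response to $\sigma$ is a strategy $\tau$ with $\mathrm{Disc}_\lambda(G^{\sigma,\tau}_v)\le \mathrm{Disc}_\lambda(G^{\sigma,\tau'}_v)$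 for all $\tau'$ and all $v$. \emph{Strategy iteration} starts from an arbitrary strategy $\sigma^0$ of player 1. In iteration $k+1$ (for $k=0,1,2,\dots$) it takes a best response $\tau^k$ to $\sigma^k$, puts $f_k(v)=\mathrm{Disc}_\lambda(G^{\sigma^k,\tau^k}_v)$, and defines $\sigma^{k+1}(v)\in\arg\max_{w\in E(v)}\bigl(r(v,w)+\lambda f_k(w)\bigr)$ for $v\in V_1$, where ties are resolved by a fixed rule that depends only on $v$ and on the set of maximizers (for instance, least index). It stops as soon as $\sigma^{k+1}=\sigma^k$ and returns $\sigma^{k+1}$. \textbf{Theorem.} There is an absolute constant $C>0$ such that for every turn-based discounted-sum game with $n$ vertices, every positive integer $W$ with $|r(e)|\le W$ for all edges $e$, every $\lambda\in[0,1)$, every tie-breaking rule, and every initial strategy $\sigma^0$, strategy iteration can be carried out (best responses exist) and, however the best responses are chosen, stops after at most \[ n^{\,C\,W^{1/4}\sqrt n} \] iterations (with $0^0=1$); the returned strategy is optimal for player 1, and the last computed payoff vector $f_k$ equals $\mathrm{val}_\lambda$. In particular, the number of iterations is sub-exponential in $n+W$, hence sub-exponential in the input size when the weights are written in unary: for every $\delta>0$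 there is $S$ such that, whenever $n+W\ge S$, strategy iteration solves the game in this sense within $2^{\delta (n+W)}$ iterations, for every $\lambda\in[0,1)$, every tie-breaking rule and every $\sigma^0$. -/

import Mathlib

universe u

/-- A turn-based game on the finite vertex set `V` with integer edge rewards. Player 1 owns the
vertices in `V₁`, player 2 owns all the others, and every vertex has an outgoing edge.
Only the values of `r` on edges matter. -/
structure DiscountedGame (V : Type u) where
  /-- vertices of player 1 -/
  V₁ : Finset V
  /-- edges -/
  E : Finset (V × V)
  /-- rewards -/
  r : V × V → ℤ
  exists_succ : ∀ v, ∃ w, (v, w) ∈ E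

/-- A way to resolve ties: `pick v S` is the element that is chosen at the vertex `v` when `S` is
the set of optimal successors. It does not depend on the discount factor; an example is the least
element of `S` for a fixed indexing of the vertices. -/
structure TieBreak (V : Type u) where
  pick : V → Finset V → V
  pick_mem : ∀ (v : V) (S : Finset V), S.Nonempty → pick v S ∈ S

namespace DiscountedGame

noncomputable section

variable {V : Type u} [Fintype V] [DecidableEq V] (G : DiscountedGame V)

/-- Positional strategies of player 1. -/
abbrev Strategy₁ : Type u := (v : {v : V // v ∈ G.V₁}) → {w : V // (v.1, w) ∈ G.E}

/-- Positional strategies of player 2. -/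
abbrev Strategy₂ : Type u := (v : {v : V // v ∉ G.V₁}) → {w : V // (v.1, w) ∈ G.E}

variable {G}

/-- The successor of a vertex once both players have fixed their strategies. -/
def next (σ : G.Strategy₁) (τ : G.Strategy₂) (v : V) : V :=
  if h : v ∈ G.V₁ then (σ ⟨v, h⟩).1 else (τ ⟨v, h⟩).1

/-- The play from `v` under the strategy profile `(σ, τ)`. -/
def play (σ : G.Strategy₁) (τ : G.Strategy₂) (v : V) (t : ℕ) : V :=
  (next σ τ)^[t] v

variable (G)

/-- The discounted payoff of a sequence of vertices. For `0 ≤ lam < 1` the series converges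
absolutely, because `V` is finite. -/
def payoff (lam : ℝ) (p : ℕ → V) : ℝ :=
  ∑' i : ℕ, lam ^ i * (G.r (p i, p (i + 1)) : ℝ)

variable {G}

/-- The vector of the discounted payoffs of the plays under `(σ, τ)`. -/
def disc (lam : ℝ) (σ : G.Strategy₁) (τ : G.Strategy₂) (v : V) : ℝ :=
  G.payoff lam (play σ τ v)

variable (G)

/-- The value of a vertex: max over `σ` of min over `τ` of the payoff (both strategy sets are
finite and nonempty, so supremum and infimum are maximum and minimum). -/
def value (lam : ℝ) (v : V) : ℝ :=
  ⨆ σ : G.Strategy₁, ⨅ τ : G.Strategy₂, disc lam σ τ v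

variable {G}

/-- Optimality of a strategy of player 1. -/
def IsOptimal (lam : ℝ) (σ : G.Strategy₁) : Prop :=
  ∀ v : V, ⨅ τ : G.Strategy₂, disc lam σ τ v = G.value lam v

/-- `τ` is a best response of player 2 to `σ`. -/
def IsBestResponse (lam : ℝ) (σ : G.Strategy₁) (τ : G.Strategy₂) : Prop :=
  ∀ (τ' : G.Strategy₂) (v : V), disc lam σ τ v ≤ disc lam σ τ' v

variable (G)

open Classical in
/-- The successors `w` of `v` that maximize `r (v, w) + lam * f w`. -/
def argmaxSucc (lam : ℝ) (f : V → ℝ) (v : V) : Finset V :=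
  Finset.univ.filter fun w => (v, w) ∈ G.E ∧
    ∀ w', (v, w') ∈ G.E → (G.r (v, w') : ℝ) + lam * f w' ≤ (G.r (v, w) : ℝ) + lam * f w

theorem argmaxSucc_nonempty (lam : ℝ) (f : V → ℝ) (v : V) : (G.argmaxSucc lam f v).Nonempty := by
  obtain ⟨w₀, h₀⟩ := G.exists_succ v
  obtain ⟨w, hw, hmax⟩ := Finset.exists_max_image
    (Finset.univ.filter fun w => (v, w) ∈ G.E)
    (fun w => (G.r (v, w) : ℝ) + lam * f w) ⟨w₀, by simpa using h₀⟩
  refine ⟨w, ?_⟩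
  simp only [Finset.mem_filter, Finset.mem_univ, true_and] at hw hmax
  simp only [argmaxSucc, Finset.mem_filter, Finset.mem_univ, true_and]
  exact ⟨hw, hmax⟩

theorem pick_argmaxSucc_mem (rule : TieBreak V) (lam : ℝ) (f : V → ℝ) (v : V) :
    (v, rule.pick v (G.argmaxSucc lam f v)) ∈ G.E := by
  have h := rule.pick_mem v _ (G.argmaxSucc_nonempty lam f v)
  simp only [argmaxSucc, Finset.mem_filter] at h
  exact h.2.1

/-- The Bellman strategy extractor for player 1: at every vertex of player 1 choose a successor
that maximizes `r (v, w) + lam * f w`, with ties resolved by `rule`. -/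
def bellman (rule : TieBreak V) (lam : ℝ) (f : V → ℝ) : G.Strategy₁ :=
  fun v => ⟨rule.pick v.1 (G.argmaxSucc lam f v.1), G.pick_argmaxSucc_mem rule lam f v.1⟩

variable {G}

/-- `σ` and `τ` are the sequences of strategies that strategy iteration goes through when it is
started from `σ₀`: `τ k` is any best response to `σ k`, and `σ (k + 1)` is the Bellman
improvement. (The sequences are continued beyond the iteration at which the algorithm stops.) -/
structure IsRun (rule : TieBreak V) (lam : ℝ) (σ₀ : G.Strategy₁)
    (σ : ℕ → G.Strategy₁) (τ : ℕ → G.Strategy₂) : Prop where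
  init : σ 0 = σ₀
  bestResponse : ∀ k, IsBestResponse lam (σ k) (τ k)
  improve : ∀ k, σ (k + 1) = G.bellman rule lam (disc lam (σ k) (τ k))

/-- The loop is left after exactly `k + 1` iterations: this is the first time that an iteration
does not change the strategy of player 1. -/
def StopsAfter (σ : ℕ → G.Strategy₁) (k : ℕ) : Prop :=
  σ (k + 1) = σ k ∧ ∀ j < k, σ (j + 1) ≠ σ j

/-- Strategy iteration started from `σ₀` solves the game within `B` iterations: it can be carried
out (best responses exist), and however the best responses are chosen, it stops after at most `B`
iterations, it returns an optimal strategy, and the payoff vector computed last is the value. -/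
def SolvesWithin (rule : TieBreak V) (lam : ℝ) (σ₀ : G.Strategy₁) (B : ℝ) : Prop :=
  (∃ σ τ, IsRun rule lam σ₀ σ τ) ∧
  ∀ σ τ, IsRun rule lam σ₀ σ τ →
    ∃ k : ℕ, StopsAfter σ k ∧ ((k + 1 : ℕ) : ℝ) ≤ B ∧
      IsOptimal lam (σ (k + 1)) ∧ ∀ v : V, disc lam (σ k) (τ k) v = G.value lam v

end

end DiscountedGame

/-! Two regimes of the discount factor λ are combined. At a fixed λ, each iteration contracts the
distance from the payoff vector to the value by the factor λ; while the value is not reached, the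
most costly current choice never returns after L iterations, provided λ^L < 1 - λ
(`exists_eliminated`). There are at most n² pairs of vertices, so about n² L iterations suffice, and
L = N² works for λ ≤ 1 - 1/N.

For λ closer to 1, all that the algorithm does is decided by comparing payoffs of lassos. Such a
comparison is the sign at λ of an integer polynomial of degree O(n) with coefficients O(W). Duality
with a Chebyshev quotient shows that it vanishes at 1 only to order O(√n W^(1/4))
(`lt_of_X_sub_one_pow_dvd`), so its first nonzero Taylor term at 1 dominates on [1 - 1/N, 1) for
some N = n^O(√n W^(1/4)) (`eval_nonneg_iff_near_one`). Hence a run for such a λ is also a run for 1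
- 1/N (`SameComparisons.isRun`), where the first regime applies. -/

open Finset Polynomial

set_option linter.unusedSectionVars false

namespace DiscountedGame

/-! ### Strategy iteration at a fixed discount factor. -/

section FixedDiscount

variable {V : Type u} [Fintype V] [DecidableEq V] {G : DiscountedGame V}

/-- The Bellman optimality equations of a discounted game have a solution. -/
theorem exists_bellman_fixedPoint (G : DiscountedGame V) {lam : ℝ} (h0 : 0 ≤ lam) (h1 : lam < 1) :
    ∃ f : V → ℝ,
      (∀ v ∈ G.V₁, IsGreatest ((fun w => (G.r (v, w) : ℝ) + lam * f w) '' {w | (v, w) ∈ G.E})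
        (f v)) ∧
      (∀ v ∉ G.V₁, IsLeast ((fun w => (G.r (v, w) : ℝ) + lam * f w) '' {w | (v, w) ∈ G.E})
        (f v)) := by
  have hne : ∀ v, (univ.filter fun w => (v, w) ∈ G.E).Nonempty := fun v => by
    obtain ⟨w, hw⟩ := G.exists_succ v
    exact ⟨w, by simpa using hw⟩
  let T : (V → ℝ) → V → ℝ := fun f v =>
    if v ∈ G.V₁ then (univ.filter fun w => (v, w) ∈ G.E).sup' (hne v)
      (fun w => (G.r (v, w) : ℝ) + lam * f w)
    else (univ.filter fun w => (v, w) ∈ G.E).inf' (hne v)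
      (fun w => (G.r (v, w) : ℝ) + lam * f w)
  have key : ∀ f g v, T f v ≤ T g v + lam * dist f g := by
    intro f g v
    have hfg : ∀ w, (G.r (v, w) : ℝ) + lam * f w ≤ G.r (v, w) + lam * g w + lam * dist f g := by
      intro w
      have hw : f w - g w ≤ dist f g :=
        (le_abs_self _).trans (by simpa [Real.dist_eq] using dist_le_pi_dist f g w)
      have := mul_le_mul_of_nonneg_left hw h0
      linarith
    by_cases hv : v ∈ G.V₁
    · simp only [T, if_pos hv]
      refine sup'_le _ _ fun w hw => (hfg w).trans ?_
      gcongr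
      exact le_sup' (fun w => (G.r (v, w) : ℝ) + lam * g w) hw
    · simp only [T, if_neg hv]
      rw [← sub_le_iff_le_add]
      refine le_inf' _ _ fun w hw => sub_le_iff_le_add.2 (le_trans ?_ (hfg w))
      exact inf'_le (fun w => (G.r (v, w) : ℝ) + lam * f w) hw
  have hT : ContractingWith ⟨lam, h0⟩ T := by
    refine ⟨by exact_mod_cast h1, LipschitzWith.of_dist_le_mul fun f g => ?_⟩
    refine (dist_pi_le_iff (by positivity)).2 fun v => ?_
    rw [Real.dist_eq, abs_sub_le_iff]
    have h₁ := key f g v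
    have h₂ := key g f v
    rw [dist_comm g f] at h₂
    exact ⟨sub_le_iff_le_add'.2 h₁, sub_le_iff_le_add'.2 h₂⟩
  have hfix : T (hT.fixedPoint T) = hT.fixedPoint T := hT.fixedPoint_isFixedPt
  set f := hT.fixedPoint T
  refine ⟨f, fun v hv => ?_, fun v hv => ?_⟩
  · have hfv := congrFun hfix v
    simp only [T, if_pos hv] at hfv
    rw [← hfv]
    constructor
    · obtain ⟨w, hw, h⟩ := exists_mem_eq_sup' (hne v) (fun w => (G.r (v, w) : ℝ) + lam * f w)
      exact ⟨w, by simpa using hw, h.symm⟩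
    · rintro _ ⟨w, hw, rfl⟩
      exact le_sup' (fun w => (G.r (v, w) : ℝ) + lam * f w) (by simpa using hw)
  · have hfv := congrFun hfix v
    simp only [T, if_neg hv] at hfv
    rw [← hfv]
    constructor
    · obtain ⟨w, hw, h⟩ := exists_mem_eq_inf' (hne v) (fun w => (G.r (v, w) : ℝ) + lam * f w)
      exact ⟨w, by simpa using hw, h.symm⟩
    · rintro _ ⟨w, hw, rfl⟩
      exact inf'_le (fun w => (G.r (v, w) : ℝ) + lam * f w) (by simpa using hw)

theorem next_of_mem {σ : G.Strategy₁} {τ : G.Strategy₂} {v : V} (h : v ∈ G.V₁) :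
    next σ τ v = (σ ⟨v, h⟩).1 := dif_pos h

theorem next_of_notMem {σ : G.Strategy₁} {τ : G.Strategy₂} {v : V} (h : v ∉ G.V₁) :
    next σ τ v = (τ ⟨v, h⟩).1 := dif_neg h

theorem edge_next (σ : G.Strategy₁) (τ : G.Strategy₂) (v : V) : (v, next σ τ v) ∈ G.E := by
  by_cases h : v ∈ G.V₁
  · rw [next_of_mem h]; exact (σ ⟨v, h⟩).2
  · rw [next_of_notMem h]; exact (τ ⟨v, h⟩).2

theorem summable_payoff (G : DiscountedGame V) {lam : ℝ} (h0 : 0 ≤ lam) (h1 : lam < 1)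
    (p : ℕ → V) : Summable fun i => lam ^ i * (G.r (p i, p (i + 1)) : ℝ) := by
  obtain ⟨M, hM⟩ := (Set.finite_range fun e : V × V => |(G.r e : ℝ)|).bddAbove
  refine Summable.of_norm_bounded ((summable_geometric_of_lt_one h0 h1).mul_right M) fun i => ?_
  rw [norm_mul, norm_pow, Real.norm_of_nonneg h0, Real.norm_eq_abs]
  exact mul_le_mul_of_nonneg_left (hM ⟨_, rfl⟩) (pow_nonneg h0 i)

theorem play_succ' (σ : G.Strategy₁) (τ : G.Strategy₂) (v : V) (t : ℕ) :
    play σ τ v (t + 1) = next σ τ (play σ τ v t) := Function.iterate_succ_apply' _ _ _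

theorem payoff_eq (G : DiscountedGame V) {lam : ℝ} (h0 : 0 ≤ lam) (h1 : lam < 1) (p : ℕ → V) :
    G.payoff lam p = G.r (p 0, p 1) + lam * G.payoff lam fun i => p (i + 1) := by
  rw [payoff, (G.summable_payoff h0 h1 p).tsum_eq_zero_add, payoff, ← tsum_mul_left]
  simp [pow_succ', mul_assoc]

theorem disc_eq {lam : ℝ} (h0 : 0 ≤ lam) (h1 : lam < 1) (σ : G.Strategy₁) (τ : G.Strategy₂)
    (v : V) : disc lam σ τ v = G.r (v, next σ τ v) + lam * disc lam σ τ (next σ τ v) := by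
  rw [disc, payoff_eq G h0 h1]
  rfl

/-- Maximum principle: at a maximizer w of h, h w ≤ lam * h w with lam < 1. It yields both
comparison lemmas below. -/
theorem nonpos_of_le_mul {lam : ℝ} (h0 : 0 ≤ lam) (h1 : lam < 1) {h : V → ℝ} {s : V → V}
    (hh : ∀ v, h v ≤ lam * h (s v)) (v : V) : h v ≤ 0 := by
  obtain ⟨w, -, hw⟩ := exists_max_image univ h ⟨v, mem_univ v⟩
  have h₁ := mul_le_mul_of_nonneg_left (hw (s w) (mem_univ _)) h0
  have h₂ := hh w
  have h₃ : h w ≤ 0 := by nlinarith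
  exact (hw v (mem_univ v)).trans h₃

theorem le_disc_of_subsolution {lam : ℝ} (h0 : 0 ≤ lam) (h1 : lam < 1) {σ : G.Strategy₁}
    {τ : G.Strategy₂} {g : V → ℝ}
    (hg : ∀ v, g v ≤ G.r (v, next σ τ v) + lam * g (next σ τ v)) (v : V) :
    g v ≤ disc lam σ τ v := by
  have := nonpos_of_le_mul h0 h1 (h := fun v => g v - disc lam σ τ v) (s := next σ τ)
    (fun v => by
      have h₁ := hg v
      have h₂ := disc_eq h0 h1 σ τ v
      simp only [mul_sub]
      linarith) v
  linarith

theorem disc_le_of_supersolution {lam : ℝ} (h0 : 0 ≤ lam) (h1 : lam < 1) {σ : G.Strategy₁}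
    {τ : G.Strategy₂} {g : V → ℝ}
    (hg : ∀ v, G.r (v, next σ τ v) + lam * g (next σ τ v) ≤ g v) (v : V) :
    disc lam σ τ v ≤ g v := by
  have := nonpos_of_le_mul h0 h1 (h := fun v => disc lam σ τ v - g v) (s := next σ τ)
    (fun v => by
      have h₁ := hg v
      have h₂ := disc_eq h0 h1 σ τ v
      simp only [mul_sub]
      linarith) v
  linarith

/-- There is a best response, and its payoff vector solves the optimality equations of player 2. -/
theorem exists_isBestResponse_and_le {lam : ℝ} (h0 : 0 ≤ lam) (h1 : lam < 1) (σ : G.Strategy₁) :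
    ∃ τ : G.Strategy₂, IsBestResponse lam σ τ ∧
      ∀ v ∉ G.V₁, ∀ w, (v, w) ∈ G.E → disc lam σ τ v ≤ G.r (v, w) + lam * disc lam σ τ w := by
  -- The game in which player 1 has no edges left but those of `σ`; its Bellman equations describe
  -- the optimal replies of player 2.
  let H : DiscountedGame V :=
    { V₁ := G.V₁
      E := G.E.filter fun e => ∀ h : e.1 ∈ G.V₁, e.2 = (σ ⟨e.1, h⟩).1
      r := G.r
      exists_succ := fun v => by
        by_cases hv : v ∈ G.V₁
        · exact ⟨(σ ⟨v, hv⟩).1, by simpa using (σ ⟨v, hv⟩).2⟩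
        · obtain ⟨w, hw⟩ := G.exists_succ v
          exact ⟨w, by simp [hw, hv]⟩ }
  obtain ⟨f, hf₁, hf₂⟩ := H.exists_bellman_fixedPoint h0 h1
  have hE : ∀ v ∉ G.V₁, ∀ w, (v, w) ∈ H.E ↔ (v, w) ∈ G.E := fun v hv w => by simp [H, hv]
  have hσ : ∀ v (hv : v ∈ G.V₁), f v = G.r (v, (σ ⟨v, hv⟩).1) + lam * f (σ ⟨v, hv⟩).1 := by
    intro v hv
    obtain ⟨w, hw, h⟩ := (hf₁ v hv).1
    have hw' : w = (σ ⟨v, hv⟩).1 := (mem_filter.1 hw).2 hv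
    rw [← hw']
    exact h.symm
  have hτ : ∀ v : {v : V // v ∉ G.V₁}, ∃ w : {w : V // (v.1, w) ∈ G.E},
      (G.r (v.1, w.1) : ℝ) + lam * f w.1 = f v.1 := by
    rintro ⟨v, hv⟩
    obtain ⟨w, hw, h⟩ := (hf₂ v hv).1
    exact ⟨⟨w, (hE v hv w).1 hw⟩, h⟩
  choose τ hτ using hτ
  have hle : ∀ v ∉ G.V₁, ∀ w, (v, w) ∈ G.E → f v ≤ G.r (v, w) + lam * f w :=
    fun v hv w hw => (hf₂ v hv).2 ⟨w, (hE v hv w).2 hw, rfl⟩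
  have hsub : ∀ τ' : G.Strategy₂, ∀ v, f v ≤ disc lam σ τ' v := by
    refine fun τ' => le_disc_of_subsolution h0 h1 fun v => ?_
    by_cases hv : v ∈ G.V₁
    · rw [next_of_mem hv]; exact (hσ v hv).le
    · exact hle v hv _ (edge_next σ τ' v)
  have heq : disc lam σ τ = f := by
    refine funext fun v => le_antisymm (disc_le_of_supersolution h0 h1 (fun v => ?_) v) (hsub τ v)
    by_cases hv : v ∈ G.V₁
    · rw [next_of_mem hv]; exact (hσ v hv).ge
    · rw [next_of_notMem hv]; exact (hτ ⟨v, hv⟩).le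
  exact ⟨τ, fun τ' v => heq ▸ hsub τ' v, heq ▸ hle⟩

/-- All best responses have the same payoff vector, so the inequality passes over from the one
constructed above. -/
theorem IsBestResponse.le {lam : ℝ} (h0 : 0 ≤ lam) (h1 : lam < 1) {σ : G.Strategy₁}
    {τ : G.Strategy₂} (h : IsBestResponse lam σ τ) {v w : V} (hv : v ∉ G.V₁)
    (hw : (v, w) ∈ G.E) : disc lam σ τ v ≤ G.r (v, w) + lam * disc lam σ τ w := by
  obtain ⟨τ', hτ', hle⟩ := exists_isBestResponse_and_le h0 h1 σ
  have heq : disc lam σ τ = disc lam σ τ' := funext fun v => le_antisymm (h τ' v) (hτ' τ v)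
  rw [heq]
  exact hle v hv w hw

theorem IsBestResponse.iInf_eq {lam : ℝ} {σ : G.Strategy₁}
    {τ : G.Strategy₂} (h : IsBestResponse lam σ τ) (v : V) :
    ⨅ τ' : G.Strategy₂, disc lam σ τ' v = disc lam σ τ v := by
  have : Nonempty G.Strategy₂ := ⟨τ⟩
  exact le_antisymm (ciInf_le (Set.finite_range _).bddBelow τ) (le_ciInf fun τ' => h τ' v)

/-- Positional determinacy. -/
theorem exists_saddlePoint (G : DiscountedGame V) {lam : ℝ} (h0 : 0 ≤ lam) (h1 : lam < 1) :
    ∃ (σ : G.Strategy₁) (τ : G.Strategy₂), disc lam σ τ = G.value lam ∧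
      (∀ v ∈ G.V₁, ∀ w, (v, w) ∈ G.E → G.r (v, w) + lam * G.value lam w ≤ G.value lam v) ∧
      (∀ v ∉ G.V₁, ∀ w, (v, w) ∈ G.E → G.value lam v ≤ G.r (v, w) + lam * G.value lam w) := by
  obtain ⟨f, hf₁, hf₂⟩ := G.exists_bellman_fixedPoint h0 h1
  have hσ : ∀ v : {v : V // v ∈ G.V₁}, ∃ w : {w : V // (v.1, w) ∈ G.E},
      (G.r (v.1, w.1) : ℝ) + lam * f w.1 = f v.1 := by
    rintro ⟨v, hv⟩
    obtain ⟨w, hw, h⟩ := (hf₁ v hv).1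
    exact ⟨⟨w, hw⟩, h⟩
  choose σ hσ using hσ
  have hτ : ∀ v : {v : V // v ∉ G.V₁}, ∃ w : {w : V // (v.1, w) ∈ G.E},
      (G.r (v.1, w.1) : ℝ) + lam * f w.1 = f v.1 := by
    rintro ⟨v, hv⟩
    obtain ⟨w, hw, h⟩ := (hf₂ v hv).1
    exact ⟨⟨w, hw⟩, h⟩
  choose τ hτ using hτ
  have hge : ∀ σ' : G.Strategy₁, ∀ v, disc lam σ' τ v ≤ f v := by
    refine fun σ' => disc_le_of_supersolution h0 h1 fun v => ?_
    by_cases hv : v ∈ G.V₁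
    · exact (hf₁ v hv).2 ⟨_, edge_next σ' τ v, rfl⟩
    · rw [next_of_notMem hv]; exact (hτ ⟨v, hv⟩).le
  have hle : ∀ τ' : G.Strategy₂, ∀ v, f v ≤ disc lam σ τ' v := by
    refine fun τ' => le_disc_of_subsolution h0 h1 fun v => ?_
    by_cases hv : v ∈ G.V₁
    · rw [next_of_mem hv]; exact (hσ ⟨v, hv⟩).ge
    · exact (hf₂ v hv).2 ⟨_, edge_next σ τ' v, rfl⟩
  have hval : G.value lam = f := by
    have : Nonempty G.Strategy₁ := ⟨σ⟩
    have : Nonempty G.Strategy₂ := ⟨τ⟩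
    refine funext fun v => le_antisymm (ciSup_le fun σ' => ?_) ?_
    · exact (ciInf_le (Set.finite_range _).bddBelow τ).trans (hge σ' v)
    · exact (le_ciInf fun τ' => hle τ' v).trans
        (le_ciSup (f := fun σ' : G.Strategy₁ => ⨅ τ' : G.Strategy₂, disc lam σ' τ' v)
          (Set.finite_range _).bddAbove σ)
  rw [hval]
  exact ⟨σ, τ, funext fun v => le_antisymm (hge σ v) (hle τ v),
    fun v hv w hw => (hf₁ v hv).2 ⟨w, hw, rfl⟩, fun v hv w hw => (hf₂ v hv).2 ⟨w, hw, rfl⟩⟩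

theorem IsBestResponse.disc_le_value {lam : ℝ} {σ : G.Strategy₁} {τ : G.Strategy₂}
    (h : IsBestResponse lam σ τ) (v : V) : disc lam σ τ v ≤ G.value lam v := by
  have : Nonempty G.Strategy₁ := ⟨σ⟩
  rw [← h.iInf_eq]
  exact le_ciSup (f := fun σ' : G.Strategy₁ => ⨅ τ' : G.Strategy₂, disc lam σ' τ' v)
    (Set.finite_range _).bddAbove σ

theorem bellman_spec (rule : TieBreak V) (lam : ℝ) (f : V → ℝ) {v : V} (hv : v ∈ G.V₁) {w : V}
    (hw : (v, w) ∈ G.E) : (G.r (v, w) : ℝ) + lam * f w ≤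
      G.r (v, (G.bellman rule lam f ⟨v, hv⟩).1) + lam * f (G.bellman rule lam f ⟨v, hv⟩).1 := by
  have h := rule.pick_mem v _ (G.argmaxSucc_nonempty lam f v)
  simp only [argmaxSucc, mem_filter] at h
  exact h.2.2 w hw

theorem exists_isRun (rule : TieBreak V) {lam : ℝ} (h0 : 0 ≤ lam) (h1 : lam < 1)
    (σ₀ : G.Strategy₁) : ∃ σ τ, IsRun rule lam σ₀ σ τ := by
  choose β hβ _ using fun σ : G.Strategy₁ => exists_isBestResponse_and_le h0 h1 σ
  let σ : ℕ → G.Strategy₁ := fun k =>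
    Nat.rec σ₀ (fun _ σ => G.bellman rule lam (disc lam σ (β σ))) k
  exact ⟨σ, fun k => β (σ k), rfl, fun k => hβ _, fun k => rfl⟩

namespace IsRun

variable {rule : TieBreak V} {lam : ℝ} {σ₀ : G.Strategy₁} {σ : ℕ → G.Strategy₁}
  {τ : ℕ → G.Strategy₂}

theorem improve_le (hr : IsRun rule lam σ₀ σ τ) (k : ℕ) {v : V} (hv : v ∈ G.V₁) {w : V}
    (hw : (v, w) ∈ G.E) : (G.r (v, w) : ℝ) + lam * disc lam (σ k) (τ k) w ≤
      G.r (v, (σ (k + 1) ⟨v, hv⟩).1) + lam * disc lam (σ k) (τ k) (σ (k + 1) ⟨v, hv⟩).1 := by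
  rw [hr.improve k]
  exact bellman_spec rule lam _ hv hw

theorem disc_mono (hr : IsRun rule lam σ₀ σ τ) (h0 : 0 ≤ lam) (h1 : lam < 1) (k : ℕ) (v : V) :
    disc lam (σ k) (τ k) v ≤ disc lam (σ (k + 1)) (τ (k + 1)) v := by
  refine le_disc_of_subsolution h0 h1 (fun v => ?_) v
  by_cases hv : v ∈ G.V₁
  · rw [next_of_mem hv, disc_eq h0 h1 (σ k) (τ k) v]
    exact hr.improve_le k hv (edge_next _ _ _)
  · exact (hr.bestResponse k).le h0 h1 hv (edge_next _ _ _)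

/-- An improvement step gains at least as much as a step of value iteration: at vertices of player 1
the new choice is compared with an optimal one, at the others the value itself satisfies the
one-step inequality. -/
theorem value_sub_disc_succ_le (hr : IsRun rule lam σ₀ σ τ) (h0 : 0 ≤ lam) (h1 : lam < 1) {k : ℕ}
    {M : ℝ} (hM : ∀ v, G.value lam v - disc lam (σ k) (τ k) v ≤ M) (v : V) :
    G.value lam v - disc lam (σ (k + 1)) (τ (k + 1)) v ≤ lam * M := by
  obtain ⟨σs, τs, hst, hmax, hmin⟩ := G.exists_saddlePoint h0 h1
  have hM' : ∀ v, G.value lam v - disc lam (σ (k + 1)) (τ (k + 1)) v ≤ M := fun v => by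
    have := hr.disc_mono h0 h1 k v
    have := hM v
    linarith
  have e := disc_eq h0 h1 (σ (k + 1)) (τ (k + 1)) v
  by_cases hv : v ∈ G.V₁
  · rw [next_of_mem hv] at e
    have e' := disc_eq h0 h1 σs τs v
    rw [hst] at e'
    have h₁ := hr.improve_le k hv (edge_next σs τs v)
    have h₂ := mul_le_mul_of_nonneg_left (hM (next σs τs v)) h0
    have h₃ := mul_le_mul_of_nonneg_left
      (hr.disc_mono h0 h1 k (σ (k + 1) ⟨v, hv⟩).1) h0
    linarith
  · have h₁ := hmin v hv _ (edge_next (σ (k + 1)) (τ (k + 1)) v)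
    have h₂ := mul_le_mul_of_nonneg_left (hM' (next (σ (k + 1)) (τ (k + 1)) v)) h0
    linarith

theorem value_sub_disc_add_le (hr : IsRun rule lam σ₀ σ τ) (h0 : 0 ≤ lam) (h1 : lam < 1) {k : ℕ}
    {M : ℝ} (hM : ∀ v, G.value lam v - disc lam (σ k) (τ k) v ≤ M) (j : ℕ) (v : V) :
    G.value lam v - disc lam (σ (k + j)) (τ (k + j)) v ≤ lam ^ j * M := by
  induction j generalizing v with
  | zero => simpa using hM v
  | succ j ih =>
    rw [pow_succ', mul_assoc]
    exact hr.value_sub_disc_succ_le h0 h1 ih v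

/-- While the value is not reached, some choice of the current strategy disappears for good after
`L` iterations. -/
theorem exists_eliminated (hr : IsRun rule lam σ₀ σ τ) (h0 : 0 ≤ lam) (h1 : lam < 1) {L : ℕ}
    (hL : lam ^ L < 1 - lam) {k : ℕ} (hk : disc lam (σ k) (τ k) ≠ G.value lam) :
    ∃ v, ∀ j, k + L ≤ j → σ j v ≠ σ k v := by
  obtain ⟨σs, τs, hst, hmax, hmin⟩ := G.exists_saddlePoint h0 h1
  -- The one-step loss of a choice, measured against the value. If M is the largest loss in `σ k`,
  -- the gap to the value is at most M / (1 - lam), hence at most lam ^ i * M / (1 - lam) after i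
  -- more iterations. Reusing the worst choice would force a gap of at least M, impossible for i ≥
  -- L.
  let c : {v : V // v ∈ G.V₁} → G.Strategy₁ → ℝ := fun v σ =>
    G.value lam v - (G.r (v, (σ v).1) + lam * G.value lam (σ v).1)
  have hbound : ∀ M, 0 ≤ M → (∀ v, c v (σ k) ≤ M) →
      ∀ v, G.value lam v - disc lam (σ k) (τ k) v ≤ M / (1 - lam) := by
    intro M hM hc v
    have hM1 : M / (1 - lam) = M + lam * (M / (1 - lam)) := by
      have : 1 - lam ≠ 0 := by linarith
      field_simp
      ring
    have := le_disc_of_subsolution h0 h1 (σ := σ k) (τ := τ k)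
      (g := fun v => G.value lam v - M / (1 - lam)) (fun v => by
        rw [mul_sub]
        by_cases hv : v ∈ G.V₁
        · rw [next_of_mem hv]
          have := hc ⟨v, hv⟩
          simp only [c] at this
          linarith
        · have := hmin v hv _ (edge_next (σ k) (τ k) v)
          linarith) v
    linarith
  have hpos : ∃ v, 0 < c v (σ k) := by
    by_contra! hc
    refine hk (funext fun v => le_antisymm ((hr.bestResponse k).disc_le_value v) ?_)
    have := hbound 0 le_rfl hc v
    simp only [zero_div] at this
    linarith
  obtain ⟨v₀, hv₀⟩ := hpos
  obtain ⟨v, -, hv⟩ := exists_max_image univ (fun v => c v (σ k)) ⟨v₀, mem_univ _⟩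
  have hM : 0 < c v (σ k) := hv₀.trans_le (hv v₀ (mem_univ _))
  refine ⟨v, fun j hj heq => ?_⟩
  obtain ⟨i, rfl⟩ := Nat.exists_eq_add_of_le (show k ≤ j by omega)
  have h₁ := hr.value_sub_disc_add_le h0 h1
    (hbound _ hM.le fun w => hv w (mem_univ _)) i v
  have h₂ : c v (σ k) ≤ G.value lam v - disc lam (σ (k + i)) (τ (k + i)) v := by
    have e := disc_eq h0 h1 (σ (k + i)) (τ (k + i)) v
    rw [next_of_mem v.2, heq] at e
    have := mul_le_mul_of_nonneg_left
      ((hr.bestResponse (k + i)).disc_le_value (σ k v).1) h0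
    simp only [c]
    linarith
  have h₃ : lam ^ i ≤ lam ^ L := pow_le_pow_of_le_one h0 h1.le (by omega)
  have h₄ : c v (σ k) ≤ lam ^ i * (c v (σ k) / (1 - lam)) := h₂.trans h₁
  rw [← mul_div_assoc, le_div_iff₀ (by linarith)] at h₄
  nlinarith

/-- Pigeonhole: sampled every L iterations, the eliminated choices are distinct elements of V × V.
-/
theorem exists_disc_eq_value (hr : IsRun rule lam σ₀ σ τ) (h0 : 0 ≤ lam) (h1 : lam < 1) {L : ℕ}
    (hL : lam ^ L < 1 - lam) :
    ∃ k ≤ Fintype.card V ^ 2 * L, disc lam (σ k) (τ k) = G.value lam := by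
  by_contra! hne
  have hex : ∀ i : Fin (Fintype.card V ^ 2 + 1),
      ∃ v, ∀ j, i * L + L ≤ j → σ j v ≠ σ (i * L) v := fun i =>
    hr.exists_eliminated h0 h1 hL (hne _ (Nat.mul_le_mul_right _ (by omega)))
  choose v hv using hex
  have hlt : ∀ i j : Fin (Fintype.card V ^ 2 + 1), i < j →
      ((v i).1, (σ (i * L) (v i)).1) ≠ ((v j).1, (σ (j * L) (v j)).1) := by
    intro i j hij heq
    have hvv : v i = v j := Subtype.ext (Prod.ext_iff.1 heq).1
    refine hv i (j * L) ?_ (Subtype.ext ?_)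
    · have : (i : ℕ) + 1 ≤ j := hij
      nlinarith
    · rw [hvv] at heq ⊢
      exact (Prod.ext_iff.1 heq).2.symm
  have hinj : Function.Injective fun i : Fin (Fintype.card V ^ 2 + 1) =>
      ((v i).1, (σ (i * L) (v i)).1) := by
    intro i j heq
    rcases lt_trichotomy i j with h | h | h
    · exact absurd heq (hlt i j h)
    · exact h
    · exact absurd heq.symm (hlt j i h)
  have := Fintype.card_le_of_injective _ hinj
  rw [Fintype.card_fin, Fintype.card_prod, ← sq] at this
  omega

theorem exists_stopsAfter (hr : IsRun rule lam σ₀ σ τ) (h0 : 0 ≤ lam) (h1 : lam < 1) {L : ℕ}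
    (hL : lam ^ L < 1 - lam) : ∃ k ≤ Fintype.card V ^ 2 * L + 1, StopsAfter σ k := by
  classical
  obtain ⟨k, hk, hval⟩ := hr.exists_disc_eq_value h0 h1 hL
  have hval' : disc lam (σ (k + 1)) (τ (k + 1)) = G.value lam := funext fun v =>
    le_antisymm ((hr.bestResponse (k + 1)).disc_le_value v) (hval ▸ hr.disc_mono h0 h1 k v)
  -- From the value on, both strategies are extracted from the same vector by the same rule. `σ k`
  -- itself may still differ from `σ (k + 1)` by ties, which costs one more iteration.
  have hk' : σ (k + 1 + 1) = σ (k + 1) := by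
    rw [hr.improve (k + 1), hval', hr.improve k, hval]
  have hex : ∃ j, σ (j + 1) = σ j := ⟨k + 1, hk'⟩
  refine ⟨Nat.find hex, ?_, Nat.find_spec hex, fun j hj => Nat.find_min hex hj⟩
  exact (Nat.find_min' hex hk').trans (Nat.add_le_add_right hk 1)

/-- If nothing changes, the payoff vector also solves player 1's optimality inequalities against `τ
k`, so even an optimal strategy earns no more against `τ k`. -/
theorem disc_eq_value_of_succ_eq (hr : IsRun rule lam σ₀ σ τ) (h0 : 0 ≤ lam) (h1 : lam < 1)
    {k : ℕ} (hk : σ (k + 1) = σ k) : disc lam (σ k) (τ k) = G.value lam := by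
  obtain ⟨σs, τs, hst, hmax, hmin⟩ := G.exists_saddlePoint h0 h1
  refine funext fun v => le_antisymm ((hr.bestResponse k).disc_le_value v) ?_
  refine le_trans ?_ (disc_le_of_supersolution (σ := σs) (τ := τ k) h0 h1 (fun v => ?_) v)
  · refine le_disc_of_subsolution h0 h1 (fun v => ?_) v
    by_cases hv : v ∈ G.V₁
    · have e := disc_eq h0 h1 σs τs v
      rw [hst, next_of_mem hv] at e
      rw [next_of_mem hv]
      exact e.le
    · exact hmin v hv _ (edge_next _ _ _)
  · rw [disc_eq h0 h1 (σ k) (τ k) v]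
    by_cases hv : v ∈ G.V₁
    · have h := hr.improve_le k hv (edge_next σs (τ k) v)
      rwa [hk, ← next_of_mem (τ := τ k) hv] at h
    · rw [next_of_notMem hv, next_of_notMem hv]

theorem isOptimal_of_disc_eq_value (hr : IsRun rule lam σ₀ σ τ) {k : ℕ}
    (hk : disc lam (σ k) (τ k) = G.value lam) : IsOptimal lam (σ k) := fun v => by
  rw [(hr.bestResponse k).iInf_eq, hk]

end IsRun

end FixedDiscount

end DiscountedGame

/-! ### Integer polynomials near 1: order of vanishing and sign. -/

namespace Polynomial

theorem coeff_sum_range_C_mul_X_pow {R : Type*} [Semiring R] (f : ℕ → R) (n j : ℕ) :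
    (∑ i ∈ range n, C (f i) * X ^ i).coeff j = if j < n then f j else 0 := by
  simp [coeff_X_pow]

theorem natDegree_sum_range_C_mul_X_pow_le {R : Type*} [Semiring R] (f : ℕ → R) (n : ℕ) :
    (∑ i ∈ range n, C (f i) * X ^ i).natDegree ≤ n :=
  natDegree_le_iff_coeff_eq_zero.2 fun j hj => by
    rw [coeff_sum_range_C_mul_X_pow, if_neg (by omega)]

/-- A polynomial that vanishes to order `k` at `1` annihilates the polynomials of degree less
than `k` under the pairing of coefficients with values at the natural numbers. -/
theorem sum_coeff_mul_eval_eq_zero {P q : ℝ[X]} {d k : ℕ} (hd : P.natDegree ≤ d)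
    (hP : (X - 1) ^ k ∣ P) (hq : q.natDegree < k) :
    ∑ i ∈ range (d + 1), P.coeff i * q.eval (i : ℝ) = 0 := by
  -- Induction with the operator X * d/dX, which multiplies the i-th coefficient by i and costs one
  -- order of vanishing.
  have hmon : ∀ j (P : ℝ[X]), P.natDegree ≤ d → (X - 1) ^ (j + 1) ∣ P →
      ∑ i ∈ range (d + 1), P.coeff i * (i : ℝ) ^ j = 0 := by
    intro j
    induction j with
    | zero =>
      intro P hd hP
      have h1 : P.eval 1 = 0 := by
        obtain ⟨Q, rfl⟩ := hP
        simp
      rw [eval_eq_sum_range' (Nat.lt_succ_of_le hd)] at h1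
      simpa using h1
    | succ j ih =>
      intro P hd hP
      have hdeg : (X * derivative P).natDegree ≤ d := by
        refine natDegree_le_iff_coeff_eq_zero.2 fun i hi => ?_
        obtain ⟨i, rfl⟩ : ∃ i', i = i' + 1 := ⟨i - 1, by omega⟩
        rw [coeff_X_mul, coeff_derivative, coeff_eq_zero_of_natDegree_lt (by omega), zero_mul]
      have hdvd : (X - 1) ^ (j + 1) ∣ X * derivative P :=
        Dvd.dvd.mul_left (pow_sub_one_dvd_derivative_of_pow_dvd hP) _
      rw [← ih _ hdeg hdvd]
      refine sum_congr rfl fun i _ => ?_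
      cases i with
      | zero => simp
      | succ i =>
        rw [coeff_X_mul, coeff_derivative]
        push_cast
        ring
  simp_rw [eval_eq_sum_range' hq, mul_sum]
  rw [sum_comm]
  refine sum_eq_zero fun j hj => ?_
  have hj' : j + 1 ≤ k := mem_range.1 hj
  have := hmon j P hd ((pow_dvd_pow _ hj').trans hP)
  calc ∑ i ∈ range (d + 1), P.coeff i * (q.coeff j * (i : ℝ) ^ j)
      = q.coeff j * ∑ i ∈ range (d + 1), P.coeff i * (i : ℝ) ^ j := by
        rw [mul_sum]; exact sum_congr rfl fun i _ => by ring
    _ = 0 := by rw [this, mul_zero]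

/-- A polynomial of degree less than `m` which equals `m ^ 2` at `1` and is small at the points
of `[-1, 1]` that are far from `1`. -/
theorem exists_fejer_polynomial (m : ℕ) (hm : 1 ≤ m) :
    ∃ q : ℝ[X], q.natDegree ≤ m - 1 ∧ q.eval 1 = (m : ℝ) ^ 2 ∧
      ∀ y : ℝ, -1 ≤ y → y < 1 → |q.eval y| ≤ 2 / (1 - y) := by
  -- The witness is (T_m - 1) / (X - 1): its value at 1 is T_m'(1) = m², and |T_m| ≤ 1 on [-1, 1]
  -- gives the decay.
  have hroot : (X - C (1 : ℝ)) ∣ (Chebyshev.T ℝ m - 1) := by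
    rw [dvd_iff_isRoot]
    simp
  obtain ⟨q, hq⟩ := hroot
  refine ⟨q, ?_, ?_, fun y hy hy1 => ?_⟩
  · rcases eq_or_ne q 0 with rfl | hq0
    · simp
    have h := congrArg natDegree hq
    rw [natDegree_mul (X_sub_C_ne_zero 1) hq0, natDegree_X_sub_C] at h
    have h' : (Chebyshev.T ℝ m - 1).natDegree ≤ m := by
      refine (natDegree_sub_le _ _).trans ?_
      simp
    omega
  · have h := congrArg (fun p => (derivative p).eval 1) hq
    simp only [derivative_sub, derivative_mul, derivative_X, derivative_C, derivative_one,
      eval_sub, eval_add, eval_mul, eval_X, eval_C, eval_one, Chebyshev.derivative_T_eval_one] at h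
    simp at h
    exact h.symm
  · have h := congrArg (eval y) hq
    simp only [eval_sub, eval_mul, eval_X, eval_C, eval_one] at h
    have hT := Chebyshev.abs_eval_T_real_le_one (m : ℤ) (abs_le.2 ⟨hy, hy1.le⟩)
    rw [le_div_iff₀ (by linarith), ← abs_of_pos (show 0 < 1 - y by linarith), ← abs_mul]
    have : q.eval y * (1 - y) = 1 - (Chebyshev.T ℝ m).eval y := by linarith
    rw [this, abs_le]
    rw [abs_le] at hT
    constructor <;> linarith

theorem sum_range_inv_sq_le (d : ℕ) : ∑ s ∈ range d, (1 : ℝ) / ((s : ℝ) + 1) ^ 2 ≤ 2 := by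
  have h : ∀ d : ℕ, ∑ s ∈ range d, (1 : ℝ) / ((s : ℝ) + 1) ^ 2 ≤ 2 - 1 / (d : ℝ) := by
    intro d
    induction d with
    | zero => norm_num
    | succ d ih =>
      rw [sum_range_succ]
      rcases Nat.eq_zero_or_pos d with rfl | hd
      · norm_num
      have hd' : (0 : ℝ) < d := by exact_mod_cast hd
      have : (1 : ℝ) / ((d : ℝ) + 1) ^ 2 ≤ 1 / (d : ℝ) - 1 / ((d + 1 : ℕ) : ℝ) := by
        push_cast
        rw [div_sub_div _ _ hd'.ne' (by positivity), div_le_div_iff₀ (by positivity) (by positivity)]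
        nlinarith
      linarith
  exact (h d).trans (by
    have : (0 : ℝ) ≤ 1 / (d : ℝ) := by positivity
    linarith)

/-- The order of vanishing at `1` of an integer polynomial of degree at most `d` with coefficients
bounded by `H` is `O(d ^ (1/2) * H ^ (1/4))`. -/
theorem lt_of_X_sub_one_pow_dvd {P : ℤ[X]} (hP0 : P ≠ 0) {d H m k : ℕ} (hd : P.natDegree ≤ d)
    (hH : ∀ i, |P.coeff i| ≤ H) (hm : 2 * d ^ 2 * H < m ^ 4) (hdvd : (X - 1) ^ k ∣ P) :
    k ≤ 2 * m - 2 := by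
  by_contra! hk
  have hm1 : 1 ≤ m := by
    rcases Nat.eq_zero_or_pos m with rfl | h
    · simp at hm
    · exact h
  obtain ⟨q₀, hdeg, hone, hsmall⟩ := exists_fejer_polynomial m hm1
  set i₀ := P.natTrailingDegree
  have hi₀ : i₀ ≤ d := (natTrailingDegree_le_natDegree P).trans hd
  -- The affine substitution sends i₀ to 1 and i₀, ..., d into [-1, 1]. So q is m ^ 4 at the lowest
  -- nonzero coefficient and at most (d / (s + 1))² at i₀ + 1 + s; if P annihilated q, then m ^ 4 ≤
  -- 2 * d ^ 2 * H. For d = 0 the slope is 0 and the tail is empty.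
  set q : ℝ[X] := (q₀.comp (C (-(2 / (d : ℝ))) * X + C (1 + 2 / (d : ℝ) * i₀))) ^ 2
  have hqdeg : q.natDegree < k := by
    refine lt_of_le_of_lt ?_ hk
    refine natDegree_pow_le.trans ?_
    have h := (natDegree_comp_le (p := q₀)
      (q := C (-(2 / (d : ℝ))) * X + C (1 + 2 / (d : ℝ) * i₀)))
    have h' : (C (-(2 / (d : ℝ))) * X + C (1 + 2 / (d : ℝ) * i₀)).natDegree ≤ 1 := natDegree_linear_le
    have h'' := h.trans (Nat.mul_le_mul hdeg h')
    omega
  have hqeval : ∀ x : ℝ, q.eval x = (q₀.eval (1 - 2 / d * (x - i₀))) ^ 2 := by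
    intro x
    simp only [q, eval_pow, eval_comp, eval_add, eval_mul, eval_C, eval_X]
    congr 2
    ring
  have hsum := sum_coeff_mul_eval_eq_zero (P := P.map (Int.castRingHom ℝ)) (d := d) (k := k)
    (natDegree_map_le.trans hd)
    (by simpa using Polynomial.map_dvd (Int.castRingHom ℝ) hdvd) hqdeg
  have hterm : ∀ s < d - i₀, |(P.coeff (i₀ + 1 + s) : ℝ) * q.eval ((i₀ + 1 + s : ℕ) : ℝ)| ≤
      H * d ^ 2 * (1 / ((s : ℝ) + 1) ^ 2) := by
    intro s hs
    have hdpos : (0 : ℝ) < d := by exact_mod_cast (show 0 < d by omega)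
    have hsd : (s : ℝ) + 1 ≤ d := by exact_mod_cast (show s + 1 ≤ d by omega)
    have hs0 : (0 : ℝ) < (s : ℝ) + 1 := by positivity
    have harg : (1 : ℝ) - 2 / d * (((i₀ + 1 + s : ℕ) : ℝ) - i₀) = 1 - 2 * ((s + 1) / d) := by
      push_cast; ring
    have hfrac : ((s : ℝ) + 1) / d ≤ 1 := (div_le_one hdpos).2 hsd
    have hfrac0 : 0 < ((s : ℝ) + 1) / d := by positivity
    have hq₀ := hsmall (1 - 2 * ((s + 1) / d)) (by linarith) (by linarith)
    have hq₀' : (2 : ℝ) / (1 - (1 - 2 * ((s + 1) / d))) = d / (s + 1) := by field_simp; ring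
    rw [hq₀'] at hq₀
    rw [abs_mul, hqeval, harg, abs_pow]
    have hc : |(P.coeff (i₀ + 1 + s) : ℝ)| ≤ H := by exact_mod_cast hH (i₀ + 1 + s)
    calc _ ≤ (H : ℝ) * (d / (s + 1)) ^ 2 := by gcongr
      _ = _ := by rw [div_pow, mul_one_div, mul_div_assoc]
  have hlow : ∀ i < i₀, P.coeff i = 0 := fun i hi => coeff_eq_zero_of_lt_natTrailingDegree hi
  have hsplit : range (d + 1) = range (i₀ + (1 + (d - i₀))) := by congr 1; omega
  rw [hsplit, sum_range_add, sum_eq_zero (fun i hi => by simp [hlow i (mem_range.1 hi)]), zero_add,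
    sum_range_add, sum_range_one] at hsum
  simp only [coeff_map, eq_intCast, add_zero, ← add_assoc] at hsum
  have hmain : (m : ℝ) ^ 4 ≤ |(P.coeff i₀ : ℝ) * q.eval (i₀ : ℝ)| := by
    rw [hqeval, sub_self, mul_zero, sub_zero, hone, abs_mul, ← pow_mul,
      abs_of_nonneg (show (0 : ℝ) ≤ (m : ℝ) ^ (2 * 2) by positivity)]
    have : (1 : ℝ) ≤ |(P.coeff i₀ : ℝ)| := by
      have : P.coeff i₀ ≠ 0 := trailingCoeff_nonzero_iff_nonzero.2 hP0
      exact_mod_cast Int.one_le_abs this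
    exact le_mul_of_one_le_left (show (0 : ℝ) ≤ (m : ℝ) ^ 4 by positivity) this
  have htail : |∑ s ∈ range (d - i₀),
      (P.coeff (i₀ + 1 + s) : ℝ) * q.eval ((i₀ + 1 + s : ℕ) : ℝ)| ≤ H * d ^ 2 * 2 := by
    refine (abs_sum_le_sum_abs _ _).trans
      ((sum_le_sum fun s hs => hterm s (mem_range.1 hs)).trans ?_)
    rw [← mul_sum]
    gcongr
    exact sum_range_inv_sq_le _
  have heq : (P.coeff i₀ : ℝ) * q.eval (i₀ : ℝ) = -∑ s ∈ range (d - i₀),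
      (P.coeff (i₀ + 1 + s) : ℝ) * q.eval ((i₀ + 1 + s : ℕ) : ℝ) := by linarith
  rw [heq, abs_neg] at hmain
  have hm' : (2 : ℝ) * d ^ 2 * H < m ^ 4 := by exact_mod_cast hm
  linarith

/-- The j-th coefficient is the sum of P_i * (i choose j), and i choose j ≤ (d + 1) ^ j. -/
theorem abs_coeff_taylor_one_le {P : ℤ[X]} {d H : ℕ} (hd : P.natDegree ≤ d)
    (hH : ∀ i, |P.coeff i| ≤ H) (j : ℕ) :
    |(taylor 1 P).coeff j| ≤ H * ((d : ℤ) + 1) ^ (j + 1) := by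
  have hexp : (taylor 1 P).coeff j = ∑ i ∈ range (d + 1), P.coeff i * (i.choose j : ℤ) := by
    conv_lhs => rw [P.as_sum_range_C_mul_X_pow' (Nat.lt_succ_of_le hd)]
    simp only [map_sum, taylor_mul, taylor_C, taylor_X_pow, finsetSum_coeff, coeff_C_mul, C_1,
      coeff_X_add_one_pow]
  rw [hexp]
  calc _ ≤ ∑ i ∈ range (d + 1), |P.coeff i * (i.choose j : ℤ)| := abs_sum_le_sum_abs _ _
    _ ≤ ∑ i ∈ range (d + 1), (H : ℤ) * ((d : ℤ) + 1) ^ j := by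
        refine sum_le_sum fun i hi => ?_
        rw [abs_mul, Nat.abs_cast]
        have h1 : i.choose j ≤ (d + 1) ^ j :=
          (Nat.choose_le_pow i j).trans (Nat.pow_le_pow_left (mem_range.1 hi).le j)
        have h2 : ((i.choose j : ℕ) : ℤ) ≤ ((d : ℤ) + 1) ^ j := by exact_mod_cast h1
        exact mul_le_mul (hH i) h2 (by positivity) (by positivity)
    _ = _ := by
        rw [sum_const, card_range, nsmul_eq_mul]
        push_cast
        ring

/-- A nonzero integer polynomial has a constant nonzero sign on an explicit interval to the left
of `1`. -/
theorem eval_nonneg_iff_near_one {P : ℤ[X]} {d H m : ℕ} (hd : P.natDegree ≤ d)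
    (hH : ∀ i, |P.coeff i| ≤ H) (hm : 2 * d ^ 2 * H < m ^ 4) {x y : ℝ}
    (hx : (1 - x) * (H * (d + 1) ^ (2 * m + 1)) ≤ 1) (hx1 : x < 1)
    (hy : (1 - y) * (H * (d + 1) ^ (2 * m + 1)) ≤ 1) (hy1 : y < 1) :
    0 ≤ aeval x P ↔ 0 ≤ aeval y P := by
  rcases eq_or_ne P 0 with rfl | hP0
  · simp
  set R := taylor 1 P with hR
  have hR0 : R ≠ 0 := fun h => hP0 (taylor_injective 1 (by simpa [hR] using h))
  set k := R.natTrailingDegree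
  obtain ⟨S, hS⟩ : X ^ k ∣ R :=
    X_pow_dvd_iff.2 fun j hj => coeff_eq_zero_of_lt_natTrailingDegree hj
  have hPS : P = (X - 1) ^ k * taylor (-1) S := by
    have : P = taylor (-1) R := by simp [hR, taylor_taylor]
    rw [this, hS, taylor_mul, taylor_X_pow]
    simp [sub_eq_add_neg]
  have hm1 : 1 ≤ m := by
    rcases Nat.eq_zero_or_pos m with rfl | h
    · simp at hm
    · exact h
  have hk : k ≤ 2 * m - 2 := lt_of_X_sub_one_pow_dvd hP0 hd hH hm ⟨_, hPS⟩
  have hScoeff : ∀ s, S.coeff s = R.coeff (k + s) := fun s => by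
    rw [hS, add_comm, coeff_X_pow_mul]
  have hSdeg : S.natDegree < d + 1 := by
    refine Nat.lt_succ_of_le (natDegree_le_iff_coeff_eq_zero.2 fun s hs => ?_)
    rw [hScoeff]
    refine coeff_eq_zero_of_natDegree_lt ?_
    rw [hR, natDegree_taylor]
    omega
  have hS0 : S.coeff 0 ≠ 0 := by
    rw [hScoeff]
    exact trailingCoeff_nonzero_iff_nonzero.2 hR0
  -- With P = (X - 1) ^ k * S(X - 1), the integer S(0) has modulus at least 1. Once the other terms
  -- add up to less than 1, it alone decides the sign, by a criterion free of x.
  have key : ∀ x : ℝ, (1 - x) * (H * (d + 1) ^ (2 * m + 1)) ≤ 1 → x < 1 →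
      (0 ≤ aeval x P ↔ 0 < (-1) ^ k * S.coeff 0) := by
    intro x hx hx1
    have hε : 0 < 1 - x := by linarith
    set ε := 1 - x
    have hH1 : (1 : ℝ) ≤ H := by
      have h1 : P.coeff P.natDegree ≠ 0 := leadingCoeff_ne_zero.2 hP0
      have := (Int.one_le_abs h1).trans (hH _)
      exact_mod_cast this
    have hd1 : (1 : ℝ) ≤ (d : ℝ) + 1 := by
      have : (0 : ℝ) ≤ d := by positivity
      linarith
    have hεd : ((d : ℝ) + 1) * ε ≤ 1 := by
      refine le_trans ?_ hx
      have h1 : (d : ℝ) + 1 ≤ (d + 1) ^ (2 * m + 1) := le_self_pow₀ hd1 (by omega)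
      nlinarith [mul_le_mul hH1 h1 (by positivity) (by positivity)]
    have heval : aeval x P = ε ^ k * ((-1) ^ k * (S.coeff 0 : ℝ) +
        (-1) ^ k * ∑ s ∈ range d, (S.coeff (s + 1) : ℝ) * (-ε) ^ (s + 1)) := by
      have hSx : aeval x (taylor (-1) S) = aeval (-ε) S := by
        rw [taylor_apply, aeval_comp]
        simp [ε, sub_eq_add_neg]
      have hSsum : aeval (-ε) S = ∑ s ∈ range (d + 1), (S.coeff s : ℝ) * (-ε) ^ s := by
        rw [aeval_eq_sum_range' hSdeg]
        simp
      rw [hPS, map_mul, hSx, hSsum, sum_range_succ']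
      simp only [map_pow, map_sub, aeval_X, map_one, pow_zero, mul_one]
      rw [show x - 1 = -1 * ε by simp [ε], mul_pow]
      ring
    have htail : |(-1) ^ k * ∑ s ∈ range d, (S.coeff (s + 1) : ℝ) * (-ε) ^ (s + 1)| < 1 := by
      rw [abs_mul, abs_pow, abs_neg, abs_one, one_pow, one_mul]
      calc _ ≤ ∑ s ∈ range d, |(S.coeff (s + 1) : ℝ) * (-ε) ^ (s + 1)| :=
            abs_sum_le_sum_abs _ _
        _ ≤ ∑ s ∈ range d, (H : ℝ) * (d + 1) ^ (2 * m) * ε := by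
            refine sum_le_sum fun s _ => ?_
            have hc : |(S.coeff (s + 1) : ℝ)| ≤ H * ((d : ℝ) + 1) ^ (k + (s + 1) + 1) := by
              rw [hScoeff]
              exact_mod_cast abs_coeff_taylor_one_le hd hH (k + (s + 1))
            rw [abs_mul, abs_pow, abs_neg, abs_of_pos hε]
            calc _ ≤ H * ((d : ℝ) + 1) ^ (k + (s + 1) + 1) * ε ^ (s + 1) := by gcongr
              _ = H * ((d : ℝ) + 1) ^ (k + 2) * ε * (((d : ℝ) + 1) * ε) ^ s := by
                  rw [mul_pow]; ring
              _ ≤ H * ((d : ℝ) + 1) ^ (k + 2) * ε * 1 := by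
                  gcongr
                  exact pow_le_one₀ (by positivity) hεd
              -- Here the vanishing order enters: k + 2 ≤ 2 * m. Summing the d terms accounts for
              -- the last factor d + 1.
              _ ≤ H * ((d : ℝ) + 1) ^ (2 * m) * ε * 1 := by
                  gcongr
                  · omega
              _ = _ := mul_one _
        _ = d * (H * (d + 1) ^ (2 * m) * ε) := by
            rw [sum_const, card_range, nsmul_eq_mul]
        _ < (d + 1) * (H * (d + 1) ^ (2 * m) * ε) := by
            gcongr
            linarith
        _ = ε * (H * (d + 1) ^ (2 * m + 1)) := by ring
        _ ≤ 1 := hx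
    rw [heval, mul_nonneg_iff_of_pos_left (by positivity)]
    rw [abs_lt] at htail
    have hz : (-1) ^ k * S.coeff 0 ≠ 0 := mul_ne_zero (by simp) hS0
    constructor
    · intro h
      have : (-1 : ℝ) < ((-1) ^ k * S.coeff 0 : ℤ) := by push_cast; linarith
      have : (-1 : ℤ) < (-1) ^ k * S.coeff 0 := by exact_mod_cast this
      omega
    · intro h
      have : (1 : ℝ) ≤ ((-1) ^ k * S.coeff 0 : ℤ) := by exact_mod_cast h
      push_cast at this
      linarith
  rw [key x hx hx1, key y hy hy1]

end Polynomial

/-! ### Discounted sums of eventually periodic sequences. -/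

namespace Polynomial

/-- The generating function of an eventually periodic integer sequence. -/
theorem exists_aeval_eq_of_eventuallyPeriodic {a : ℕ → ℤ} {W p c : ℕ} (hW : ∀ i, |a i| ≤ W)
    (ha : ∀ i, p ≤ i → a (i + c) = a i) :
    ∃ Q : ℤ[X], Q.natDegree ≤ p + c ∧ (∀ i, |Q.coeff i| ≤ 3 * (W : ℤ)) ∧
      ∀ x : ℝ, 0 ≤ x → x < 1 → aeval x Q = (1 - x ^ c) * ∑' i, x ^ i * (a i : ℝ) := by
  -- Multiplying by 1 - x^c cancels the periodic part. What survives is a_i for i < c and, shifted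
  -- by c, a_(i+c) - a_i for i < p; hence the bound 3W = W + 2W.
  refine ⟨∑ i ∈ range c, C (a i) * X ^ i + (∑ i ∈ range p, C (a (i + c) - a i) * X ^ i) * X ^ c,
    ?_, fun i => ?_, fun x h0 h1 => ?_⟩
  · refine natDegree_add_le_of_degree_le ?_ ?_
    · exact (natDegree_sum_range_C_mul_X_pow_le a c).trans (by omega)
    · refine natDegree_mul_le.trans (add_le_add ?_ (natDegree_X_pow_le c))
      exact natDegree_sum_range_C_mul_X_pow_le (fun i => a (i + c) - a i) p
  · have h₁ : |(∑ i ∈ range c, C (a i) * X ^ i).coeff i| ≤ (W : ℤ) := by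
      rw [coeff_sum_range_C_mul_X_pow]
      split_ifs
      · exact hW i
      · simp
    have h₂ : ∀ i, |(∑ i ∈ range p, C (a (i + c) - a i) * X ^ i).coeff i| ≤ 2 * (W : ℤ) := by
      intro i
      rw [coeff_sum_range_C_mul_X_pow (fun i => a (i + c) - a i)]
      split_ifs
      · refine (abs_sub _ _).trans ?_
        linarith [hW (i + c), hW i]
      · simp
    have h₃ : |((∑ i ∈ range p, C (a (i + c) - a i) * X ^ i) * X ^ c).coeff i| ≤ 2 * (W : ℤ) := by
      rw [coeff_mul_X_pow']
      split_ifs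
      · exact h₂ _
      · simp
    rw [coeff_add]
    refine (abs_add_le _ _).trans ?_
    linarith
  · have hs : Summable fun i => x ^ i * (a i : ℝ) := by
      refine Summable.of_norm_bounded ((summable_geometric_of_lt_one h0 h1).mul_right (W : ℝ))
        fun i => ?_
      rw [norm_mul, norm_pow, Real.norm_of_nonneg h0, Real.norm_eq_abs]
      have : |(a i : ℝ)| ≤ W := by exact_mod_cast hW i
      gcongr
    have hs' : Summable fun i => x ^ (i + c) * (a (i + c) : ℝ) :=
      (summable_nat_add_iff (f := fun i => x ^ i * (a i : ℝ)) c).2 hs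
    have e₁ := hs.sum_add_tsum_nat_add c
    have e₂ : ∑' i, x ^ (i + c) * (a (i + c) : ℝ) - x ^ c * ∑' i, x ^ i * (a i : ℝ) =
        ∑ i ∈ range p, x ^ (i + c) * ((a (i + c) : ℝ) - a i) := by
      rw [← tsum_mul_left, ← hs'.tsum_sub (hs.mul_left _), tsum_eq_sum (s := range p)]
      · exact sum_congr rfl fun i _ => by ring
      · intro i hi
        rw [ha i (by simpa using hi)]
        ring
    have e₃ : aeval x ((∑ i ∈ range p, C (a (i + c) - a i) * X ^ i) * X ^ c) =
        ∑ i ∈ range p, x ^ (i + c) * ((a (i + c) : ℝ) - a i) := by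
      simp only [map_mul, map_sum, map_pow, aeval_X, aeval_C, sum_mul, map_sub]
      exact sum_congr rfl fun i _ => by simp; ring
    have e₄ : aeval x (∑ i ∈ range c, C (a i) * X ^ i) = ∑ i ∈ range c, x ^ i * (a i : ℝ) := by
      simp only [map_mul, map_sum, map_pow, aeval_X, aeval_C]
      exact sum_congr rfl fun i _ => by simp; ring
    rw [map_add, e₃, e₄]
    linarith

/-- The comparison of the discounted sums of two eventually periodic integer sequences does not
depend on the discount factor, as long as that is close enough to `1`. -/
theorem tsum_le_tsum_iff_near_one {a b : ℕ → ℤ} {W p c p' c' D m : ℕ}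
    (hWa : ∀ i, |a i| ≤ W) (hWb : ∀ i, |b i| ≤ W)
    (hc : c ≠ 0) (hc' : c' ≠ 0) (hD : p + c ≤ D) (hD' : p' + c' ≤ D)
    (ha : ∀ i, p ≤ i → a (i + c) = a i) (hb : ∀ i, p' ≤ i → b (i + c') = b i)
    (hm : 2 * (2 * D) ^ 2 * (12 * W) < m ^ 4) {x y : ℝ}
    (hx : (1 - x) * (12 * W * (2 * D + 1) ^ (2 * m + 1)) ≤ 1) (hx0 : 0 ≤ x) (hx1 : x < 1)
    (hy : (1 - y) * (12 * W * (2 * D + 1) ^ (2 * m + 1)) ≤ 1) (hy0 : 0 ≤ y) (hy1 : y < 1) :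
    ∑' i, x ^ i * (a i : ℝ) ≤ ∑' i, x ^ i * (b i : ℝ) ↔
      ∑' i, y ^ i * (a i : ℝ) ≤ ∑' i, y ^ i * (b i : ℝ) := by
  obtain ⟨A, hAd, hAc, hA⟩ := exists_aeval_eq_of_eventuallyPeriodic hWa ha
  obtain ⟨B, hBd, hBc, hB⟩ := exists_aeval_eq_of_eventuallyPeriodic hWb hb
  have hcoeff : ∀ (Q : ℤ[X]) (c : ℕ), (∀ i, |Q.coeff i| ≤ 3 * (W : ℤ)) →
      ∀ i, |(Q * (1 - X ^ c)).coeff i| ≤ 6 * (W : ℤ) := by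
    intro Q c hQ i
    rw [mul_sub, mul_one, coeff_sub, coeff_mul_X_pow']
    refine (abs_sub _ _).trans ?_
    have h : |if c ≤ i then Q.coeff (i - c) else 0| ≤ 3 * (W : ℤ) := by
      split_ifs
      · exact hQ _
      · simp
    linarith [hQ i]
  have hdeg : ∀ (Q : ℤ[X]) (c : ℕ), Q.natDegree ≤ D → c ≤ D →
      (Q * (1 - X ^ c)).natDegree ≤ 2 * D := by
    intro Q c hQ hc
    refine natDegree_mul_le.trans ?_
    have : (1 - X ^ c : ℤ[X]).natDegree ≤ c := by
      refine (natDegree_sub_le _ _).trans ?_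
      simp
    omega
  -- The difference of the two sums, cleared of its positive denominators. Each of the two products
  -- at most doubles 3W, and the subtraction gives 12W.
  set P := B * (1 - X ^ c) - A * (1 - X ^ c')
  have hPd : P.natDegree ≤ 2 * D :=
    (natDegree_sub_le _ _).trans
      (max_le (hdeg B c (by omega) (by omega)) (hdeg A c' (by omega) (by omega)))
  have hPc : ∀ i, |P.coeff i| ≤ ((12 * W : ℕ) : ℤ) := by
    intro i
    rw [coeff_sub]
    refine (abs_sub _ _).trans ?_
    push_cast
    linarith [hcoeff B c hBc i, hcoeff A c' hAc i]
  have hsign : ∀ x : ℝ, 0 ≤ x → x < 1 →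
      (∑' i, x ^ i * (a i : ℝ) ≤ ∑' i, x ^ i * (b i : ℝ) ↔ 0 ≤ aeval x P) := by
    intro x h0 h1
    have e : aeval x P = (1 - x ^ c) * (1 - x ^ c') *
        (∑' i, x ^ i * (b i : ℝ) - ∑' i, x ^ i * (a i : ℝ)) := by
      simp only [P, map_sub, map_mul, map_one, map_pow, aeval_X, hA x h0 h1, hB x h0 h1]
      ring
    have h₁ : 0 < 1 - x ^ c := sub_pos.2 (pow_lt_one₀ h0 h1 hc)
    have h₂ : 0 < 1 - x ^ c' := sub_pos.2 (pow_lt_one₀ h0 h1 hc')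
    rw [e, mul_nonneg_iff_of_pos_left (mul_pos h₁ h₂), sub_nonneg]
  rw [hsign x hx0 hx1, hsign y hy0 hy1]
  exact eval_nonneg_iff_near_one hPd hPc hm (by push_cast; exact hx) hx1 (by push_cast; exact hy)
    hy1

end Polynomial

/-! ### Transfer of runs between discount factors near 1. -/

namespace DiscountedGame

section NearOne

variable {V : Type u} [Fintype V] [DecidableEq V] {G : DiscountedGame V}

theorem exists_period_play (σ : G.Strategy₁) (τ : G.Strategy₂) (v : V) :
    ∃ p c, c ≠ 0 ∧ p + c ≤ Fintype.card V ∧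
      ∀ i, p ≤ i → play σ τ v (i + c) = play σ τ v i := by
  obtain ⟨i, j, hij, h⟩ := Fintype.exists_ne_map_eq_of_card_lt
    (fun i : Fin (Fintype.card V + 1) => play σ τ v i) (by simp)
  wlog hlt : i < j generalizing i j
  · exact this j i hij.symm h.symm (lt_of_le_of_ne (not_lt.1 hlt) hij.symm)
  have hlt' : (i : ℕ) < j := hlt
  refine ⟨i, j - i, by omega, by omega, fun t ht => ?_⟩
  obtain ⟨s, rfl⟩ := Nat.exists_eq_add_of_le' ht
  have e : s + (i : ℕ) + (j - i) = s + j := by omega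
  rw [e]
  simp only [play, Function.iterate_add_apply] at h ⊢
  rw [h]

/-- A walk in the game graph with a preperiod and a period whose sum is at most `D`. -/
structure IsLasso (G : DiscountedGame V) (D : ℕ) (p : ℕ → V) : Prop where
  edge : ∀ i, (p i, p (i + 1)) ∈ G.E
  period : ∃ q c, c ≠ 0 ∧ q + c ≤ D ∧ ∀ i, q ≤ i → p (i + c) = p i

/-- The `+ 1` leaves room for the initial edge of `consWalk`, so that plays and one-step deviations
share one bound. -/
theorem isLasso_play (σ : G.Strategy₁) (τ : G.Strategy₂) (v : V) :
    IsLasso G (Fintype.card V + 1) (play σ τ v) where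
  edge i := by rw [play_succ']; exact edge_next _ _ _
  period := by
    obtain ⟨p, c, hc, hpc, h⟩ := exists_period_play σ τ v
    exact ⟨p, c, hc, by omega, h⟩

/-- The sequence `v` followed by `p`. -/
def consWalk (v : V) (p : ℕ → V) : ℕ → V
  | 0 => v
  | i + 1 => p i

theorem isLasso_consWalk_play (σ : G.Strategy₁) (τ : G.Strategy₂) {v w : V} (h : (v, w) ∈ G.E) :
    IsLasso G (Fintype.card V + 1) (consWalk v (play σ τ w)) where
  edge i := by
    cases i with
    | zero => exact h
    | succ i => exact (isLasso_play σ τ w).edge i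
  period := by
    obtain ⟨p, c, hc, hpc, h⟩ := exists_period_play σ τ w
    refine ⟨p + 1, c, hc, by omega, fun i hi => ?_⟩
    obtain ⟨i, rfl⟩ := Nat.exists_eq_add_of_le' (show 1 ≤ i by omega)
    rw [show i + 1 + c = i + c + 1 by omega]
    exact h i (by omega)

/-- The quantities maximized by `argmaxSucc` are thus lasso payoffs too. -/
theorem payoff_consWalk_play {lam : ℝ} (h0 : 0 ≤ lam) (h1 : lam < 1) (σ : G.Strategy₁)
    (τ : G.Strategy₂) (v w : V) :
    G.payoff lam (consWalk v (play σ τ w)) = G.r (v, w) + lam * disc lam σ τ w := by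
  rw [payoff_eq G h0 h1]
  rfl

/-- Two discount factors are indistinguishable when they compare the payoffs of all lassos in the
same way. -/
def SameComparisons (G : DiscountedGame V) (x y : ℝ) : Prop :=
  ∀ p q, IsLasso G (Fintype.card V + 1) p → IsLasso G (Fintype.card V + 1) q →
    (G.payoff x p ≤ G.payoff x q ↔ G.payoff y p ≤ G.payoff y q)

theorem sameComparisons_near_one {W m : ℕ} (hW : ∀ e ∈ G.E, |G.r e| ≤ (W : ℤ))
    (hm : 2 * (2 * (Fintype.card V + 1)) ^ 2 * (12 * W) < m ^ 4) {x y : ℝ}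
    (hx : (1 - x) * (12 * W * (2 * (Fintype.card V + 1) + 1) ^ (2 * m + 1)) ≤ 1)
    (hx0 : 0 ≤ x) (hx1 : x < 1)
    (hy : (1 - y) * (12 * W * (2 * (Fintype.card V + 1) + 1) ^ (2 * m + 1)) ≤ 1)
    (hy0 : 0 ≤ y) (hy1 : y < 1) : SameComparisons G x y := by
  intro p q hp hq
  obtain ⟨i, c, hc, hD, hper⟩ := hp.period
  obtain ⟨i', c', hc', hD', hper'⟩ := hq.period
  refine tsum_le_tsum_iff_near_one (a := fun i => G.r (p i, p (i + 1)))
    (b := fun i => G.r (q i, q (i + 1))) (fun i => hW _ (hp.edge i)) (fun i => hW _ (hq.edge i))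
    hc hc' hD hD' (fun j hj => ?_) (fun j hj => ?_) hm (by push_cast; exact hx) hx0 hx1
    (by push_cast; exact hy) hy0 hy1
  · rw [add_right_comm, hper j hj, hper (j + 1) (by omega)]
  · rw [add_right_comm, hper' j hj, hper' (j + 1) (by omega)]

theorem SameComparisons.isBestResponse {x y : ℝ} (h : SameComparisons G x y) {σ : G.Strategy₁}
    {τ : G.Strategy₂} (hb : IsBestResponse x σ τ) : IsBestResponse y σ τ := fun τ' v =>
  (h _ _ (isLasso_play σ τ v) (isLasso_play σ τ' v)).1 (hb τ' v)

theorem SameComparisons.argmaxSucc_eq {x y : ℝ} (h : SameComparisons G x y) (hx0 : 0 ≤ x)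
    (hx1 : x < 1) (hy0 : 0 ≤ y) (hy1 : y < 1) (σ : G.Strategy₁) (τ : G.Strategy₂) (v : V) :
    G.argmaxSucc x (disc x σ τ) v = G.argmaxSucc y (disc y σ τ) v := by
  refine filter_congr fun w _ => and_congr_right fun hw => forall₂_congr fun w' hw' => ?_
  rw [← payoff_consWalk_play hx0 hx1, ← payoff_consWalk_play hx0 hx1,
    ← payoff_consWalk_play hy0 hy1, ← payoff_consWalk_play hy0 hy1]
  exact h _ _ (isLasso_consWalk_play σ τ hw') (isLasso_consWalk_play σ τ hw)

/-- Best responses and sets of maximizers agree for x and y, and the tie-breaking rule sees only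
these sets. -/
theorem SameComparisons.isRun {x y : ℝ} (h : SameComparisons G x y) (hx0 : 0 ≤ x)
    (hx1 : x < 1) (hy0 : 0 ≤ y) (hy1 : y < 1) {rule : TieBreak V} {σ₀ : G.Strategy₁}
    {σ : ℕ → G.Strategy₁} {τ : ℕ → G.Strategy₂} (hr : IsRun rule x σ₀ σ τ) :
    IsRun rule y σ₀ σ τ where
  init := hr.init
  bestResponse k := h.isBestResponse (hr.bestResponse k)
  improve k := by
    rw [hr.improve k]
    refine funext fun v => Subtype.ext ?_
    simp only [bellman]
    rw [h.argmaxSucc_eq hx0 hx1 hy0 hy1]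

theorem solvesWithin_of_exists_stopsAfter {rule : TieBreak V} {lam : ℝ} (h0 : 0 ≤ lam)
    (h1 : lam < 1) {σ₀ : G.Strategy₁} {B : ℝ}
    (h : ∀ σ τ, IsRun rule lam σ₀ σ τ → ∃ k, StopsAfter σ k ∧ ((k + 1 : ℕ) : ℝ) ≤ B) :
    SolvesWithin rule lam σ₀ B := by
  refine ⟨exists_isRun rule h0 h1 σ₀, fun σ τ hr => ?_⟩
  obtain ⟨k, hk, hB⟩ := h σ τ hr
  have hval := hr.disc_eq_value_of_succ_eq h0 h1 hk.1
  refine ⟨k, hk, hB, ?_, fun v => congrFun hval v⟩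
  rw [hk.1]
  exact hr.isOptimal_of_disc_eq_value hval

/-- From lam ^ N ≤ 1/e follows lam ^ (N ^ 2) ≤ e^(-N) < 1 / N. -/
theorem pow_lt_one_sub {lam : ℝ} (h0 : 0 ≤ lam) {N : ℕ} (hN : 1 ≤ N)
    (h : lam ≤ 1 - 1 / (N : ℝ)) : lam ^ (N ^ 2) < 1 - lam := by
  have hN' : (0 : ℝ) < N := by exact_mod_cast hN
  have h₁ : lam ^ N ≤ Real.exp (-1) := by
    calc lam ^ N ≤ (Real.exp (-(1 / (N : ℝ)))) ^ N := by
          gcongr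
          linarith [Real.add_one_le_exp (-(1 / (N : ℝ)))]
      _ = Real.exp (-1) := by
          rw [← Real.exp_nat_mul]
          congr 1
          field_simp
  calc lam ^ (N ^ 2) = (lam ^ N) ^ N := by rw [sq, pow_mul]
    _ ≤ Real.exp (-1) ^ N := by gcongr
    _ = (Real.exp N)⁻¹ := by
        rw [← Real.exp_nat_mul, ← Real.exp_neg]
        congr 1
        ring
    _ < 1 / (N : ℝ) := by
        rw [one_div]
        have := Real.add_one_le_exp (N : ℝ)
        gcongr
        linarith
    _ ≤ 1 - lam := by linarith

/-- A bound on the number of iterations that holds for all discount factors. -/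
theorem solvesWithin_of_le {W m N : ℕ} (hW : ∀ e ∈ G.E, |G.r e| ≤ (W : ℤ))
    (hm : 2 * (2 * (Fintype.card V + 1)) ^ 2 * (12 * W) < m ^ 4) (hN1 : 1 ≤ N)
    (hN : 12 * W * (2 * (Fintype.card V + 1) + 1) ^ (2 * m + 1) ≤ N) {lam : ℝ} (h0 : 0 ≤ lam)
    (h1 : lam < 1) (rule : TieBreak V) (σ₀ : G.Strategy₁) {B : ℝ}
    (hB : ((Fintype.card V ^ 2 * N ^ 2 + 2 : ℕ) : ℝ) ≤ B) : SolvesWithin rule lam σ₀ B := by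
  have hN' : (0 : ℝ) < N := by exact_mod_cast hN1
  have hone : 1 / (N : ℝ) ≤ 1 := (div_le_one hN').2 (by exact_mod_cast hN1)
  have hpos : (0 : ℝ) < 1 / (N : ℝ) := by positivity
  refine solvesWithin_of_exists_stopsAfter h0 h1 fun σ τ hr => ?_
  suffices ∃ k ≤ Fintype.card V ^ 2 * N ^ 2 + 1, StopsAfter σ k by
    obtain ⟨k, hk, hs⟩ := this
    exact ⟨k, hs, le_trans (by exact_mod_cast Nat.add_le_add_right hk 1) hB⟩
  -- The threshold 1 - 1 / N belongs to both regimes, so it can stand in for every larger `lam`.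
  rcases le_total lam (1 - 1 / (N : ℝ)) with hlam | hlam
  · exact hr.exists_stopsAfter h0 h1 (pow_lt_one_sub h0 hN1 hlam)
  · have hNr : (12 * W * (2 * (Fintype.card V + 1) + 1) ^ (2 * m + 1) : ℝ) ≤ N := by
      exact_mod_cast hN
    have hnear : ∀ x : ℝ, x < 1 → 1 - 1 / (N : ℝ) ≤ x →
        (1 - x) * (12 * W * (2 * (Fintype.card V + 1) + 1) ^ (2 * m + 1)) ≤ 1 := by
      intro x hx1 hx
      calc _ ≤ 1 / (N : ℝ) * N := mul_le_mul (by linarith) hNr (by positivity) hpos.le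
        _ = 1 := by field_simp
    have hlam0 : 0 ≤ 1 - 1 / (N : ℝ) := by linarith
    have hlam1 : 1 - 1 / (N : ℝ) < 1 := by linarith
    have hsame : SameComparisons G lam (1 - 1 / (N : ℝ)) :=
      sameComparisons_near_one hW hm (hnear lam h1 hlam) h0 h1 (hnear _ hlam1 le_rfl) hlam0 hlam1
    exact (hsame.isRun h0 h1 hlam0 hlam1 hr).exists_stopsAfter hlam0 hlam1
      (pow_lt_one_sub hlam0 hN1 le_rfl)

theorem solvesWithin_of_card_le_one (hV : Fintype.card V ≤ 1) {lam : ℝ} (h0 : 0 ≤ lam)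
    (h1 : lam < 1) (rule : TieBreak V) (σ₀ : G.Strategy₁) : SolvesWithin rule lam σ₀ 1 := by
  have := Fintype.card_le_one_iff_subsingleton.1 hV
  exact solvesWithin_of_exists_stopsAfter h0 h1 fun σ τ _ =>
    ⟨0, ⟨Subsingleton.elim _ _, by simp⟩, by simp⟩

theorem SolvesWithin.mono {rule : TieBreak V} {lam : ℝ} {σ₀ : G.Strategy₁} {B B' : ℝ}
    (h : SolvesWithin rule lam σ₀ B) (hB : B ≤ B') : SolvesWithin rule lam σ₀ B' := by
  refine ⟨h.1, fun σ τ hr => ?_⟩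
  obtain ⟨k, hk, hkB, hopt⟩ := h.2 σ τ hr
  exact ⟨k, hk, hkB.trans hB, hopt⟩

end NearOne

end DiscountedGame

/-! ### Choice of parameters and the final bounds. -/

namespace DiscountedGame

theorem exists_iteration_parameters {n W : ℕ} (hn : 2 ≤ n) (hW : 1 ≤ W) :
    ∃ m N : ℕ, 2 * (2 * (n + 1)) ^ 2 * (12 * W) < m ^ 4 ∧ 1 ≤ N ∧
      12 * W * (2 * (n + 1) + 1) ^ (2 * m + 1) ≤ N ∧
      ((n ^ 2 * N ^ 2 + 2 : ℕ) : ℝ) ≤ (n : ℝ) ^ (85 * (W : ℝ) ^ (1 / 4 : ℝ) * √(n : ℝ)) := by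
  have hn' : (2 : ℝ) ≤ n := by exact_mod_cast hn
  have hn1 : (1 : ℝ) ≤ n := by linarith
  have hn0 : (0 : ℝ) < n := by linarith
  have hW' : (1 : ℝ) ≤ W := by exact_mod_cast hW
  set x : ℝ := (W : ℝ) ^ (1 / 4 : ℝ) * √(n : ℝ) with hx
  have hx1 : 1 ≤ x :=
    one_le_mul_of_one_le_of_one_le (Real.one_le_rpow hW' (by norm_num)) (Real.one_le_sqrt.2 hn1)
  have hx4 : x ^ 4 = W * (n : ℝ) ^ 2 := by
    have h₁ : ((W : ℝ) ^ (1 / 4 : ℝ)) ^ 4 = W := by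
      rw [← Real.rpow_natCast, ← Real.rpow_mul (by linarith)]
      norm_num
    have h₂ : √(n : ℝ) ^ 4 = (n : ℝ) ^ 2 := by
      rw [show 4 = 2 * 2 by rfl, pow_mul, Real.sq_sqrt hn0.le]
    rw [hx, mul_pow, h₁, h₂]
  have hxn : x ≤ (n : ℝ) ^ x := by
    have h := one_add_mul_self_le_rpow_one_add (s := 1) (by norm_num) hx1
    have h' : (1 + 1 : ℝ) ^ x ≤ (n : ℝ) ^ x := by
      gcongr
      linarith
    linarith
  have hWx : (W : ℝ) ≤ (n : ℝ) ^ (4 * x) := by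
    calc (W : ℝ) ≤ W * (n : ℝ) ^ 2 := le_mul_of_one_le_right (by linarith) (one_le_pow₀ hn1)
      _ = x ^ 4 := hx4.symm
      _ ≤ ((n : ℝ) ^ x) ^ 4 := by gcongr
      _ = _ := by rw [← Real.rpow_natCast, ← Real.rpow_mul hn0.le]; norm_num [mul_comm]
  -- The factor 4 suffices: m ^ 4 ≥ 256 W n², while 96 W (n + 1)² ≤ 216 W n² for n ≥ 2.
  set m := ⌈4 * x⌉₊
  have hm : 4 * x ≤ m := Nat.le_ceil _
  have hm' : (m : ℝ) ≤ 5 * x := by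
    have := Nat.ceil_lt_add_one (show 0 ≤ 4 * x by linarith)
    linarith
  refine ⟨m, 12 * W * (2 * (n + 1) + 1) ^ (2 * m + 1), ?_, ?_, le_rfl, ?_⟩
  · have h₁ : (4 * x) ^ 4 ≤ (m : ℝ) ^ 4 := by gcongr
    have h₂ : ((n : ℝ) + 1) ^ 2 ≤ (3 / 2 * n) ^ 2 := by
      gcongr
      linarith
    have h₃ := mul_le_mul_of_nonneg_right h₂ (show (0 : ℝ) ≤ W by linarith)
    have h₄ : (0 : ℝ) < W * (n : ℝ) ^ 2 := by positivity
    have : (2 * (2 * ((n : ℝ) + 1)) ^ 2 * (12 * W)) < m ^ 4 := by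
      rw [mul_pow, hx4] at h₁
      nlinarith
    exact_mod_cast this
  · exact Nat.one_le_iff_ne_zero.2 (by positivity)
  · have h12 : (12 : ℝ) ≤ (n : ℝ) ^ (4 : ℝ) := by
      have : (2 : ℝ) ^ (4 : ℝ) ≤ (n : ℝ) ^ (4 : ℝ) := by gcongr
      norm_num at this ⊢
      linarith
    have hbase : 2 * ((n : ℝ) + 1) + 1 ≤ (n : ℝ) ^ (3 : ℝ) := by
      rw [show (3 : ℝ) = (3 : ℕ) by norm_num, Real.rpow_natCast]
      nlinarith [mul_le_mul hn' hn' (by norm_num) hn0.le]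
    -- With m ≤ 5x and x ≥ 1 the exponent is at most 34x + 7 ≤ 41x. Squaring gives 82x, and the
    -- remaining n³ contributes 3 ≤ 3x, whence 85.
    have hN : (12 * W * (2 * ((n : ℝ) + 1) + 1) ^ (2 * m + 1)) ≤ (n : ℝ) ^ (41 * x) := by
      calc _ ≤ (n : ℝ) ^ (4 : ℝ) * (n : ℝ) ^ (4 * x) * ((n : ℝ) ^ (3 : ℝ)) ^ (2 * m + 1) := by
            gcongr
        _ = (n : ℝ) ^ (4 + 4 * x + 3 * (2 * m + 1)) := by
            rw [← Real.rpow_natCast ((n : ℝ) ^ (3 : ℝ)), ← Real.rpow_mul hn0.le,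
              ← Real.rpow_add hn0, ← Real.rpow_add hn0]
            push_cast
            rfl
        _ ≤ _ := Real.rpow_le_rpow_of_exponent_le hn1 (by linarith)
    set M : ℝ := 12 * W * (2 * ((n : ℝ) + 1) + 1) ^ (2 * m + 1)
    have hM : 1 ≤ M := by
      have : (1 : ℝ) ≤ (2 * ((n : ℝ) + 1) + 1) ^ (2 * m + 1) := one_le_pow₀ (by linarith)
      exact one_le_mul_of_one_le_of_one_le (by linarith) this
    have hM2 : 1 ≤ M ^ 2 := one_le_pow₀ hM
    push_cast
    calc (n : ℝ) ^ 2 * M ^ 2 + 2 ≤ n * ((n : ℝ) ^ 2 * M ^ 2) := by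
          have : (2 : ℝ) * 2 * 1 ≤ n * n * M ^ 2 := by gcongr
          nlinarith
      _ ≤ n * ((n : ℝ) ^ 2 * ((n : ℝ) ^ (41 * x)) ^ 2) := by gcongr
      _ = (n : ℝ) ^ (3 + 82 * x) := by
          rw [Real.rpow_add hn0, ← Real.rpow_natCast ((n : ℝ) ^ (41 * x)), ← Real.rpow_mul hn0.le,
            show (3 : ℝ) = (3 : ℕ) by norm_num, Real.rpow_natCast,
            show 41 * x * ((2 : ℕ) : ℝ) = 82 * x by push_cast; ring]
          ring
      _ ≤ (n : ℝ) ^ (85 * x) := Real.rpow_le_rpow_of_exponent_le hn1 (by linarith)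
      _ = _ := by rw [hx, mul_assoc]

theorem solvesWithin_rpow {V : Type u} [Fintype V] [DecidableEq V] {G : DiscountedGame V} {W : ℕ}
    (hW : 1 ≤ W) (hG : ∀ e ∈ G.E, |G.r e| ≤ (W : ℤ)) {lam : ℝ} (h0 : 0 ≤ lam) (h1 : lam < 1)
    (rule : TieBreak V) (σ₀ : G.Strategy₁) :
    SolvesWithin rule lam σ₀
      ((Fintype.card V : ℝ) ^ (85 * (W : ℝ) ^ (1 / 4 : ℝ) * √(Fintype.card V : ℝ))) := by
  rcases le_or_gt (Fintype.card V) 1 with hV | hV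
  · convert solvesWithin_of_card_le_one hV h0 h1 rule σ₀
    -- For no vertices the exponent vanishes with √0, and 0 ^ 0 = 1.
    interval_cases Fintype.card V <;> simp
  · obtain ⟨m, N, hm, hN1, hN, hB⟩ := exists_iteration_parameters hV hW
    exact solvesWithin_of_le hG hm hN1 hN h0 h1 rule σ₀ hB

/-- The bound `n ^ (C * W ^ (1/4) * √n)` is sub-exponential in `n + W`. -/
theorem exists_rpow_le_two_rpow {C δ : ℝ} (hC : 0 < C) (hδ : 0 < δ) :
    ∃ S : ℕ, ∀ n W : ℕ, 2 ≤ n → S ≤ n + W →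
      (n : ℝ) ^ (C * (W : ℝ) ^ (1 / 4 : ℝ) * √(n : ℝ)) ≤ (2 : ℝ) ^ (δ * ((n : ℝ) + W)) := by
  have hlog2 : 0 < Real.log 2 := Real.log_pos (by norm_num)
  -- With t = n + W, the logarithm of the bound is at most C t^(3/4) log t, and log t = o(t^(1/4)).
  have ho := (isLittleO_log_rpow_atTop (show (0 : ℝ) < 1 / 4 by norm_num)).bound
    (show 0 < δ * Real.log 2 / C by positivity)
  obtain ⟨T, hT⟩ := Filter.eventually_atTop.1 ho
  refine ⟨⌈T⌉₊, fun n W hn hS => ?_⟩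
  have hn' : (2 : ℝ) ≤ n := by exact_mod_cast hn
  have hn0 : (0 : ℝ) < n := by linarith
  have hW0 : (0 : ℝ) ≤ W := by positivity
  set t : ℝ := (n : ℝ) + W with ht
  have ht0 : 0 < t := by linarith
  have hTt : T ≤ t := (Nat.le_ceil T).trans (by rw [ht]; exact_mod_cast hS)
  have h := hT t hTt
  rw [Real.norm_of_nonneg (by positivity : (0 : ℝ) ≤ t ^ (1 / 4 : ℝ))] at h
  have hlog : Real.log n ≤ δ * Real.log 2 / C * t ^ (1 / 4 : ℝ) :=
    (Real.log_le_log hn0 (by linarith)).trans ((le_abs_self _).trans h)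
  have hlogn : 0 ≤ Real.log n := Real.log_nonneg (by linarith)
  rw [Real.rpow_def_of_pos hn0, Real.rpow_def_of_pos (by norm_num : (0 : ℝ) < 2)]
  refine Real.exp_le_exp.2 ?_
  calc Real.log n * (C * (W : ℝ) ^ (1 / 4 : ℝ) * √(n : ℝ))
      ≤ (δ * Real.log 2 / C * t ^ (1 / 4 : ℝ)) * (C * t ^ (1 / 4 : ℝ) * t ^ (1 / 2 : ℝ)) := by
        rw [Real.sqrt_eq_rpow]
        gcongr <;> linarith
    _ = δ * Real.log 2 * (t ^ (1 / 4 : ℝ) * t ^ (1 / 4 : ℝ) * t ^ (1 / 2 : ℝ)) := by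
        field_simp
    _ = Real.log 2 * (δ * t) := by
        rw [← Real.rpow_add ht0, ← Real.rpow_add ht0]
        norm_num
        ring

end DiscountedGame

theorem mainTheorem1 :
    (∃ C : ℝ, 0 < C ∧
      ∀ (V : Type u) [Fintype V] [DecidableEq V] (G : DiscountedGame V) (W : ℕ), 1 ≤ W →
        (∀ e ∈ G.E, |G.r e| ≤ (W : ℤ)) →
        ∀ lam : ℝ, 0 ≤ lam → lam < 1 →
        ∀ (rule : TieBreak V) (σ₀ : G.Strategy₁),
          DiscountedGame.SolvesWithin rule lam σ₀
            ((Fintype.card V : ℝ) ^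
              (C * (W : ℝ) ^ (1 / 4 : ℝ) * Real.sqrt (Fintype.card V : ℝ)))) ∧
    (∀ δ : ℝ, 0 < δ → ∃ S : ℕ,
      ∀ (V : Type u) [Fintype V] [DecidableEq V] (G : DiscountedGame V) (W : ℕ), 1 ≤ W →
        (∀ e ∈ G.E, |G.r e| ≤ (W : ℤ)) →
        S ≤ Fintype.card V + W →
        ∀ lam : ℝ, 0 ≤ lam → lam < 1 →
        ∀ (rule : TieBreak V) (σ₀ : G.Strategy₁),
          DiscountedGame.SolvesWithin rule lam σ₀
            ((2 : ℝ) ^ (δ * ((Fintype.card V : ℝ) + (W : ℝ))))) := by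
  refine ⟨⟨85, by norm_num, fun V _ _ G W hW hG lam h0 h1 rule σ₀ =>
    DiscountedGame.solvesWithin_rpow hW hG h0 h1 rule σ₀⟩, fun δ hδ => ?_⟩
  obtain ⟨S, hS⟩ := DiscountedGame.exists_rpow_le_two_rpow (C := 85) (by norm_num) hδ
  refine ⟨S, fun V _ _ G W hW hG hSV lam h0 h1 rule σ₀ => ?_⟩
  rcases le_or_gt (Fintype.card V) 1 with hV | hV
  · exact (DiscountedGame.solvesWithin_of_card_le_one hV h0 h1 rule σ₀).mono
      (Real.one_le_rpow (by norm_num) (by positivity))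
  · exact (DiscountedGame.solvesWithin_rpow hW hG h0 h1 rule σ₀).mono (hS _ W hV hSV)
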